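/- Let $\mathcal N$ be an inhomogeneous Poisson process on $(0,\infty)$ with intensity measure $\mu(t)\,dt$, where $\mu(t)>0$ for Lebesgue-almost all $t\ge 0$ and $\int_0^t\mu(s)\,ds<\infty$ for every $t<\infty$. Let $T_1<T_2<\cdots$ be its epochs (points in increasing order), let $T_0=0$, and put $T_{n+1}=\infty$ if there are only $n$ epochs. For fixed $\ell>0$ let $D=\min\{T_n:\ T_n<\infty,\ T_{n+1}-T_n\ge \ell\}$ (with $D=\infty$ if there is no such $n$) be the first epoch that is followed by a gap of length at least $\ell$. Write $f(t)\approx_{\rm log} g(t)$ if $\log f(t)/\log g(t)\to 1$ as $t\to\infty$. Let $a,b>0$. As $t\to\infty$: (i) If $\mu(t)=a(\log t)^{-b}$ for all large $t$, then $\mathbb P(D>t)\approx_{\rm log} e^{-b t\log\log t/\ell}$. (ii) If $\mu(t)=a t^{-b}$ for all large $t$, then $\mathbb P(D>t)\approx_{\rm log} e^{-b t\log t/\ell}$. (iii) If $\mu(t)=a e^{-bt}$ for all large $t$, then $\mathbb P(D>t)\approx_{\rm log} e^{-b t^2/(2\ell)}$. -/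

import Mathlib

open MeasureTheory ProbabilityTheory Filter Topology

/-- The measure `M(dt) = μ(t) dt` on `(0, ∞)` with rate function `μ`. -/
noncomputable def intensityMeasure (μ : ℝ → ℝ) : Measure ℝ :=
  (volume.restrict (Set.Ioi 0)).withDensity fun t => ENNReal.ofReal (μ t)

/-- The random set `N` is a Poisson point process on `(0, ∞)` with intensity measure `M`:
numbers of points in Borel sets are random variables, they are Poisson distributed with mean `M A`
when this is finite, and they are independent over pairwise disjoint Borel sets. -/
structure IsPoissonProcess {Ω : Type*} [MeasurableSpace Ω] (P : Measure Ω)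
    (N : Ω → Set ℝ) (M : Measure ℝ) : Prop where
  subset_Ioi : ∀ ω, N ω ⊆ Set.Ioi 0
  measurable_count : ∀ A : Set ℝ, MeasurableSet A → Measurable fun ω => (N ω ∩ A).encard
  map_count : ∀ A : Set ℝ, MeasurableSet A → M A ≠ ⊤ →
    P.map (fun ω => (N ω ∩ A).encard) =
      (poissonMeasure (M A).toNNReal).map (fun k : ℕ => (k : ℕ∞))
  indep_count : ∀ A : ℕ → Set ℝ, (∀ i, MeasurableSet (A i)) →
    Pairwise (fun i j => Disjoint (A i) (A j)) →
    iIndepFun (fun i ω => (N ω ∩ A i).encard) P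

/-- The epochs of a point set `S ⊆ (0, ∞)`: `T₀ = 0`, and `Tₙ₊₁` is the first point of `S` after
`Tₙ` (it is `⊤` when there is no such point). -/
noncomputable def epoch (S : Set ℝ) : ℕ → EReal
  | 0 => 0
  | n + 1 => sInf {x : EReal | ∃ s ∈ S, x = (s : EReal) ∧ epoch S n < x}

/-- `D = min {Tₙ : Tₙ₊₁ - Tₙ ≥ ℓ}`, the first epoch (`T₀ = 0` included) that is followed by a gap
of length at least `ℓ`; it is `⊤` when there is none. As `Tₙ` is nondecreasing in `n`, the infimum
is attained whenever the set is nonempty. -/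
noncomputable def firstGap (S : Set ℝ) (ℓ : ℝ) : EReal :=
  sInf {x : EReal | ∃ n : ℕ, x = epoch S n ∧ epoch S n < ⊤ ∧ epoch S n + (ℓ : EReal) ≤ epoch S (n + 1)}

/-- Logarithmic asymptotics `f(t) ≈_log g(t)` as `t → ∞`: `log f(t) / log g(t) → 1`. -/
def ApproxLog (f g : ℝ → ℝ) : Prop :=
  Tendsto (fun t => Real.log (f t) / Real.log (g t)) atTop (𝓝 1)

/-! ### Epochs and gaps of a point set -/

/-! Survival past `t` is compared with two families of independent events. If `D > t`, each tile
`(kℓ, (k+1)ℓ]` with `kℓ ≤ t` contains a point. Conversely, points in all sparse windows `(kh, kh +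
ε]` up to a `k` with `kh > t`, where `h + ε ≤ ℓ`, force `D > t`. For disjoint windows both
probabilities are products of factors `1 - exp (-M(window))` (`measureReal_lt_firstGap_le`,
`le_measureReal_lt_firstGap`).

Write `μ = a exp (-φ)` with `φ → ∞` slowly. Minus the log of a factor is `φ (kh)` up to lower order,
whatever `ε` is, since `a` and `ε` contribute only bounded additive terms. If `Φ` is an asymptotic
primitive of `φ`, summation gives `-log ℙ(D > t)` between about `Φ t / ℓ` and `Φ t / (ℓ - ε)`; then
`ε → 0`. The three cases take `φ = b log log t`, `b log t`, `b t`, with `Φ = b t log log t`, `b t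
log t`, `b t² / 2`. -/

theorem epoch_le_epoch_succ (S : Set ℝ) (n : ℕ) : epoch S n ≤ epoch S (n + 1) := by
  rw [epoch]
  refine le_sInf ?_
  rintro x ⟨s, -, -, h⟩
  exact h.le

theorem epoch_nonneg (S : Set ℝ) (n : ℕ) : 0 ≤ epoch S n := by
  induction n with
  | zero => simp [epoch]
  | succ n ih => exact ih.trans (epoch_le_epoch_succ S n)

theorem epoch_succ_le {S : Set ℝ} {n : ℕ} {x : ℝ} (hx : x ∈ S) (h : epoch S n < x) :
    epoch S (n + 1) ≤ x := by
  rw [epoch]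
  exact sInf_le ⟨x, hx, rfl, h⟩

/-- If `S` has finitely many points in `(0, s]`, then there is a last epoch in `[0, s]`. -/
theorem exists_epoch_le_of_finite {S : Set ℝ} {s : ℝ} (hS : S ⊆ Set.Ioi 0)
    (hs : 0 ≤ s) (hfin : (S ∩ Set.Ioc 0 s).Finite) :
    ∃ n, epoch S n ≤ s ∧ ∀ x ∈ S, epoch S n < x → s < x := by
  by_contra! hcon
  -- Induction on the number of points of `(0, s]` beyond the `n`-th epoch: the next epoch is the
  -- least of them, so passing to it lowers the count.
  have key : ∀ m n : ℕ, epoch S n ≤ s →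
      ({x ∈ S ∩ Set.Ioc 0 s | epoch S n < (x : EReal)}).ncard = m → False := by
    intro m
    induction m using Nat.strong_induction_on with
    | _ m ih =>
      intro n hn hm
      have hF : ({x ∈ S ∩ Set.Ioc 0 s | epoch S n < (x : EReal)}).Finite :=
        hfin.subset (Set.sep_subset _ _)
      obtain ⟨y, hyS, hy, hys⟩ := hcon n hn
      have hne : ({x ∈ S ∩ Set.Ioc 0 s | epoch S n < (x : EReal)}).Nonempty :=
        ⟨y, ⟨hyS, hS hyS, hys⟩, hy⟩
      obtain ⟨z, hz, hzmin⟩ := Set.exists_min_image _ id hF hne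
      have hle : epoch S (n + 1) ≤ z := epoch_succ_le hz.1.1 hz.2
      have hge : (z : EReal) ≤ epoch S (n + 1) := by
        rw [epoch]
        refine le_sInf ?_
        rintro _ ⟨w, hw, rfl, hlt⟩
        rw [EReal.coe_le_coe_iff]
        by_cases hws : w ≤ s
        · exact hzmin w ⟨⟨hw, hS hw, hws⟩, hlt⟩
        · exact hz.1.2.2.trans (not_le.1 hws).le
      have heq := le_antisymm hle hge
      refine ih _ ?_ (n + 1) (heq ▸ EReal.coe_le_coe_iff.2 hz.1.2.2) rfl
      rw [← hm]
      refine Set.ncard_lt_ncard ⟨?_, ?_⟩ hF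
      · rintro x ⟨hx, hlt⟩
        exact ⟨hx, (epoch_le_epoch_succ S n).trans_lt hlt⟩
      · intro hsub
        have := (hsub hz).2
        rw [heq] at this
        exact lt_irrefl _ this
  exact key _ 0 (by simpa [epoch] using hs) rfl

/-- Before the first gap of length `ℓ`, every open window of length `ℓ` contains a point. -/
theorem inter_Ioo_nonempty_of_lt_firstGap {S : Set ℝ} {ℓ s t : ℝ} (hS : S ⊆ Set.Ioi 0)
    (hs : 0 ≤ s) (hst : s ≤ t) (hfin : (S ∩ Set.Ioc 0 s).Finite)
    (h : (t : EReal) < firstGap S ℓ) : (S ∩ Set.Ioo s (s + ℓ)).Nonempty := by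
  by_contra hne
  rw [Set.not_nonempty_iff_eq_empty, Set.eq_empty_iff_forall_notMem] at hne
  obtain ⟨n, hn, hlast⟩ := exists_epoch_le_of_finite hS hs hfin
  have hnext : ((s + ℓ : ℝ) : EReal) ≤ epoch S (n + 1) := by
    rw [epoch]
    refine le_sInf ?_
    rintro _ ⟨w, hw, rfl, hlt⟩
    rw [EReal.coe_le_coe_iff]
    by_contra! hws
    exact hne w ⟨hw, hlast w hw hlt, hws⟩
  have hle : firstGap S ℓ ≤ epoch S n := by
    refine sInf_le ⟨n, rfl, hn.trans_lt (EReal.coe_lt_top _), le_trans ?_ hnext⟩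
    rw [EReal.coe_add]
    gcongr
  exact absurd (h.trans_le (hle.trans (hn.trans (EReal.coe_le_coe_iff.2 hst)))) (lt_irrefl _)

/-- Points in each of the windows `(k h, k h + ε]`, `k ≤ K`, with `h + ε ≤ ℓ`, rule out a gap of
length `ℓ` before time `K h`. -/
theorem le_firstGap_of_nonempty {S : Set ℝ} {ℓ h ε : ℝ} (hh : 0 < h) (hℓ : h + ε ≤ ℓ)
    {K : ℕ} (hK : ∀ k ≤ K, (S ∩ Set.Ioc (k * h) (k * h + ε)).Nonempty) :
    ((K * h : ℝ) : EReal) ≤ firstGap S ℓ := by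
  refine le_sInf ?_
  rintro _ ⟨n, rfl, -, hgap⟩
  by_contra! hlt
  choose! x hx using hK
  obtain ⟨e, he⟩ : ∃ e : ℝ, epoch S n = e :=
    ⟨(epoch S n).toReal, (EReal.coe_toReal (hlt.trans (EReal.coe_lt_top _)).ne
      (((EReal.bot_lt_coe 0).trans_le (epoch_nonneg S n)).ne')).symm⟩
  have he0 : 0 ≤ e := by simpa [he] using epoch_nonneg S n
  rw [he, EReal.coe_lt_coe_iff] at hlt
  have hex : ∃ k, k ≤ K ∧ e < x k := ⟨K, le_rfl, hlt.trans (hx K le_rfl).2.1⟩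
  classical
  obtain ⟨hkK, hek⟩ := Nat.find_spec hex
  have hmin := fun m => Nat.find_min hex (m := m)
  set k := Nat.find hex
  -- Here `x k` is the first chosen point beyond `e`. For `k > 0`, minimality gives `(k - 1) h < x
  -- (k - 1) ≤ e`, so `x k ≤ k h + ε < e + h + ε`. For `k = 0`, `e ≥ 0` suffices.
  have hclose : x k < e + ℓ := by
    have hk2 := (hx k hkK).2.2
    rcases Nat.eq_zero_or_pos k with hk0 | hk0
    · rw [hk0] at hk2 ⊢
      push_cast at hk2
      linarith
    · obtain ⟨j, hj⟩ := Nat.exists_eq_add_of_lt hk0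
      have hjk : j < k := by omega
      have h1 := hmin j hjk
      push Not at h1
      have h2 := h1 (by omega)
      have h3 := (hx j (by omega)).2.1
      have h4 : (k : ℝ) = j + 1 := by rw [hj]; push_cast; ring
      rw [h4] at hk2
      linarith
  have h1 : epoch S (n + 1) ≤ x k :=
    epoch_succ_le (hx k hkK).1 (by rw [he]; exact EReal.coe_lt_coe_iff.2 hek)
  rw [he, ← EReal.coe_add] at hgap
  exact absurd (EReal.coe_le_coe_iff.1 (hgap.trans h1)) (not_le.2 hclose)

/-! ### Void probabilities of a Poisson process -/

section Poisson

variable {Ω : Type*} [MeasurableSpace Ω] {P : Measure Ω} {N : Ω → Set ℝ} {M : Measure ℝ}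

theorem IsPoissonProcess.measure_inter_eq_empty (hN : IsPoissonProcess P N M) {A : Set ℝ}
    (hA : MeasurableSet A) (hM : M A ≠ ⊤) :
    P {ω | N ω ∩ A = ∅} = ENNReal.ofReal (Real.exp (-(M A).toReal)) := by
  have h := congrArg (fun m : Measure ℕ∞ => m {0}) (hN.map_count A hA hM)
  rw [Measure.map_apply (hN.measurable_count A hA) (measurableSet_singleton _),
    Measure.map_apply .of_discrete (measurableSet_singleton _)] at h
  have h1 : (fun ω => (N ω ∩ A).encard) ⁻¹' {0} = {ω | N ω ∩ A = ∅} := by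
    ext ω; simp
  have h2 : (fun k : ℕ => (k : ℕ∞)) ⁻¹' {0} = {0} := by
    ext k; simp
  rw [h1, h2, poissonMeasure_singleton] at h
  rw [h]
  simp [ENNReal.toReal]

theorem IsPoissonProcess.measurableSet_inter_nonempty (hN : IsPoissonProcess P N M) {A : Set ℝ}
    (hA : MeasurableSet A) : MeasurableSet {ω | (N ω ∩ A).Nonempty} := by
  have h1 : {ω | (N ω ∩ A).Nonempty} = (fun ω => (N ω ∩ A).encard) ⁻¹' {0}ᶜ := by
    ext ω; simp [Set.nonempty_iff_ne_empty]
  rw [h1]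
  exact hN.measurable_count A hA (measurableSet_singleton _).compl

theorem IsPoissonProcess.measureReal_inter_nonempty [IsProbabilityMeasure P]
    (hN : IsPoissonProcess P N M) {A : Set ℝ} (hA : MeasurableSet A) (hM : M A ≠ ⊤) :
    P.real {ω | (N ω ∩ A).Nonempty} = 1 - Real.exp (-(M A).toReal) := by
  have h1 : {ω | (N ω ∩ A).Nonempty}ᶜ = {ω | N ω ∩ A = ∅} := by
    ext ω; simp [Set.not_nonempty_iff_eq_empty]
  have h2 := probReal_add_probReal_compl (μ := P) (hN.measurableSet_inter_nonempty hA)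
  rw [h1, measureReal_def P {ω | N ω ∩ A = ∅}, hN.measure_inter_eq_empty hA hM,
    ENNReal.toReal_ofReal (Real.exp_pos _).le] at h2
  linarith

theorem IsPoissonProcess.measureReal_forall_inter_nonempty [IsProbabilityMeasure P]
    (hN : IsPoissonProcess P N M) {A : ℕ → Set ℝ} (hA : ∀ i, MeasurableSet (A i))
    (hd : Pairwise fun i j => Disjoint (A i) (A j)) (hM : ∀ i, M (A i) ≠ ⊤) (n : ℕ) :
    P.real {ω | ∀ k < n, (N ω ∩ A k).Nonempty} =
      ∏ k ∈ Finset.range n, (1 - Real.exp (-(M (A k)).toReal)) := by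
  have h := (hN.indep_count A hA hd).measure_inter_preimage_eq_mul (Finset.range n)
    (sets := fun _ => {0}ᶜ) fun i _ => (measurableSet_singleton _).compl
  have h1 : ∀ k, (fun ω => (N ω ∩ A k).encard) ⁻¹' {0}ᶜ = {ω | (N ω ∩ A k).Nonempty} := by
    intro k; ext ω; simp [Set.nonempty_iff_ne_empty]
  simp only [h1] at h
  have h2 : ⋂ k ∈ Finset.range n, {ω | (N ω ∩ A k).Nonempty} =
      {ω | ∀ k < n, (N ω ∩ A k).Nonempty} := by
    ext ω; simp
  rw [measureReal_def, ← h2, h, ENNReal.toReal_prod]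
  exact Finset.prod_congr rfl fun k _ => hN.measureReal_inter_nonempty (hA k) (hM k)

/-- The law of the count is pushed forward from `ℕ`, so it has no mass at `⊤`. This supplies the
last epoch before a given time. -/
theorem IsPoissonProcess.ae_finite_inter (hN : IsPoissonProcess P N M) {A : Set ℝ}
    (hA : MeasurableSet A) (hM : M A ≠ ⊤) : ∀ᵐ ω ∂P, (N ω ∩ A).Finite := by
  have h := congrArg (fun m : Measure ℕ∞ => m {⊤}) (hN.map_count A hA hM)
  rw [Measure.map_apply (hN.measurable_count A hA) (measurableSet_singleton _),
    Measure.map_apply .of_discrete (measurableSet_singleton _)] at h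
  have h1 : (fun ω => (N ω ∩ A).encard) ⁻¹' {⊤} = {ω | ¬ (N ω ∩ A).Finite} := by
    ext ω; simp
  have h2 : (fun k : ℕ => (k : ℕ∞)) ⁻¹' {⊤} = ∅ := by
    ext k; simp
  rw [h1, h2, measure_empty] at h
  exact h

end Poisson

/-! ### Product bounds for the tail of the first gap -/

/-- The windows `(k h, k h + ε]`. -/
def window (h ε : ℝ) (k : ℕ) : Set ℝ := Set.Ioc (k * h) (k * h + ε)

theorem measurableSet_window (h ε : ℝ) (k : ℕ) : MeasurableSet (window h ε k) := measurableSet_Ioc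

theorem pairwise_disjoint_window {h ε : ℝ} (hh : 0 < h) (hε : ε ≤ h) :
    Pairwise fun i j => Disjoint (window h ε i) (window h ε j) := by
  have key : ∀ i j : ℕ, i < j → Disjoint (window h ε i) (window h ε j) := by
    intro i j hij
    rw [Set.disjoint_left]
    intro x hx hy
    have h1 : ((i : ℝ) + 1) * h ≤ j * h := by
      gcongr
      exact_mod_cast hij
    have h2 := hx.2
    have h3 := hy.1
    linarith
  intro i j hij
  rcases lt_or_gt_of_ne hij with h1 | h1
  · exact key i j h1
  · exact (key j i h1).symm

/-- The probability that the window `(k h, k h + ε]` is hit, for intensity measure `M`. -/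
noncomputable def hitProb (M : Measure ℝ) (h ε : ℝ) (k : ℕ) : ℝ :=
  1 - Real.exp (-(M (window h ε k)).toReal)

section Bounds

variable {Ω : Type*} [MeasurableSpace Ω] {P : Measure Ω} [IsProbabilityMeasure P]
  {N : Ω → Set ℝ} {M : Measure ℝ}

/-- The factors are indexed by the `k` with `kℓ ≤ t`. The inclusion of events holds only almost
surely, because it needs local finiteness. Only monotonicity of `P` is used, so measurability of `D`
plays no role. -/
theorem IsPoissonProcess.measureReal_lt_firstGap_le (hN : IsPoissonProcess P N M)
    (hM : ∀ s t : ℝ, 0 ≤ s → M (Set.Ioc s t) ≠ ⊤) {ℓ t : ℝ} (hℓ : 0 < ℓ) (ht : 0 ≤ t) :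
    P.real {ω | (t : EReal) < firstGap (N ω) ℓ} ≤
      ∏ k ∈ Finset.range (⌊t / ℓ⌋₊ + 1), hitProb M ℓ ℓ k := by
  have hprod := hN.measureReal_forall_inter_nonempty (A := window ℓ ℓ)
    (measurableSet_window ℓ ℓ) (pairwise_disjoint_window hℓ le_rfl)
    (fun k => hM _ _ (by positivity)) (⌊t / ℓ⌋₊ + 1)
  unfold hitProb
  rw [← hprod, measureReal_def, measureReal_def]
  refine ENNReal.toReal_mono (measure_ne_top _ _) (measure_mono_ae ?_)
  filter_upwards [hN.ae_finite_inter measurableSet_Ioc (hM 0 t le_rfl)] with ω hω h k hk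
  have hkt : (k : ℝ) * ℓ ≤ t := by
    rw [← le_div_iff₀ hℓ]
    exact (Nat.le_floor_iff (by positivity)).1 (Nat.lt_succ_iff.1 hk)
  refine (inter_Ioo_nonempty_of_lt_firstGap (hN.subset_Ioi ω) (by positivity) hkt
    (hω.subset ?_) h).mono ?_
  · gcongr
  · exact Set.inter_subset_inter_right _ Set.Ioo_subset_Ioc_self

theorem IsPoissonProcess.le_measureReal_lt_firstGap (hN : IsPoissonProcess P N M)
    (hM : ∀ s t : ℝ, 0 ≤ s → M (Set.Ioc s t) ≠ ⊤) {ℓ h ε : ℝ} (hh : 0 < h) (hεh : ε ≤ h)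
    (hℓ : h + ε ≤ ℓ) (t : ℝ) :
    ∏ k ∈ Finset.range (⌊t / h⌋₊ + 2), hitProb M h ε k ≤
      P.real {ω | (t : EReal) < firstGap (N ω) ℓ} := by
  have hprod := hN.measureReal_forall_inter_nonempty (A := window h ε)
    (measurableSet_window h ε) (pairwise_disjoint_window hh hεh)
    (fun k => hM _ _ (by positivity)) (⌊t / h⌋₊ + 2)
  unfold hitProb
  rw [← hprod]
  refine measureReal_mono ?_
  intro ω hω
  -- This `K` satisfies `K h > t`, which makes the inequality for `D` strict; the windows `0, ...,
  -- K` number `⌊t / h⌋₊ + 2`.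
  have h1 := le_firstGap_of_nonempty (K := ⌊t / h⌋₊ + 1) hh hℓ
    fun k hk => hω k (by omega)
  refine lt_of_lt_of_le (EReal.coe_lt_coe_iff.2 ?_) h1
  rw [← div_lt_iff₀ hh]
  push_cast
  exact Nat.lt_floor_add_one _

end Bounds

/-! ### The intensity of short windows -/

section Intensity

variable {μ : ℝ → ℝ}

theorem intensityMeasure_Ioc {s t : ℝ} (hs : 0 ≤ s) :
    intensityMeasure μ (Set.Ioc s t) = ∫⁻ x in Set.Ioc s t, ENNReal.ofReal (μ x) := by
  rw [intensityMeasure, withDensity_apply _ measurableSet_Ioc,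
    Measure.restrict_restrict measurableSet_Ioc, Set.inter_eq_left.2]
  exact fun x hx => hs.trans_lt hx.1

theorem intensityMeasure_Ioc_ne_top (hμ_int : ∀ t : ℝ, IntegrableOn μ (Set.Ioc 0 t) volume)
    (s t : ℝ) (hs : 0 ≤ s) : intensityMeasure μ (Set.Ioc s t) ≠ ⊤ := by
  rw [intensityMeasure_Ioc hs]
  exact ((hμ_int t).mono_set (Set.Ioc_subset_Ioc_left hs)).setLIntegral_lt_top.ne

theorem intensityMeasure_Ioc_ne_zero
    (hμ_pos : ∀ᵐ t ∂(volume.restrict (Set.Ioi (0 : ℝ))), 0 < μ t)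
    (hμ_int : ∀ t : ℝ, IntegrableOn μ (Set.Ioc 0 t) volume) {s t : ℝ} (hs : 0 ≤ s)
    (hst : s < t) : intensityMeasure μ (Set.Ioc s t) ≠ 0 := by
  rw [intensityMeasure_Ioc hs]
  intro h
  rw [lintegral_eq_zero_iff' ((hμ_int t).mono_set
    (Set.Ioc_subset_Ioc_left hs)).aestronglyMeasurable.aemeasurable.ennreal_ofReal] at h
  have hpos : ∀ᵐ x ∂(volume.restrict (Set.Ioc s t)), 0 < μ x :=
    ae_restrict_of_ae_restrict_of_subset (fun x hx => hs.trans_lt hx.1) hμ_pos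
  have hfalse : ∀ᵐ x ∂(volume.restrict (Set.Ioc s t)), False := by
    filter_upwards [h, hpos] with x h1 h2
    exact absurd (ENNReal.ofReal_eq_zero.1 h1) (not_le.2 h2)
  rw [ae_iff] at hfalse
  simp at hfalse
  linarith

/-- Keeps every hit probability positive, also on early windows where no formula for `μ` is
available, so no logarithm takes its default value at `0`. -/
theorem intensityMeasure_Ioc_toReal_pos
    (hμ_pos : ∀ᵐ t ∂(volume.restrict (Set.Ioi (0 : ℝ))), 0 < μ t)
    (hμ_int : ∀ t : ℝ, IntegrableOn μ (Set.Ioc 0 t) volume) {s t : ℝ} (hs : 0 ≤ s)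
    (hst : s < t) : 0 < (intensityMeasure μ (Set.Ioc s t)).toReal :=
  ENNReal.toReal_pos (intensityMeasure_Ioc_ne_zero hμ_pos hμ_int hs hst)
    (intensityMeasure_Ioc_ne_top hμ_int s t hs)

theorem intensityMeasure_Ioc_toReal_le {s ε c : ℝ} (hs : 0 ≤ s) (hε : 0 ≤ ε) (hc : 0 ≤ c)
    (h : ∀ x ∈ Set.Ioc s (s + ε), μ x ≤ c) :
    (intensityMeasure μ (Set.Ioc s (s + ε))).toReal ≤ c * ε := by
  rw [intensityMeasure_Ioc hs]
  refine ENNReal.toReal_le_of_le_ofReal (by positivity) ?_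
  calc ∫⁻ x in Set.Ioc s (s + ε), ENNReal.ofReal (μ x)
      ≤ ∫⁻ _ in Set.Ioc s (s + ε), ENNReal.ofReal c :=
        setLIntegral_mono' measurableSet_Ioc fun x hx => ENNReal.ofReal_le_ofReal (h x hx)
    _ = ENNReal.ofReal (c * ε) := by
        rw [setLIntegral_const, Real.volume_Ioc, add_sub_cancel_left, ENNReal.ofReal_mul hc]

theorem le_intensityMeasure_Ioc_toReal
    (hμ_int : ∀ t : ℝ, IntegrableOn μ (Set.Ioc 0 t) volume) {s ε c : ℝ} (hs : 0 ≤ s)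
    (hc : 0 ≤ c) (h : ∀ x ∈ Set.Ioc s (s + ε), c ≤ μ x) :
    c * ε ≤ (intensityMeasure μ (Set.Ioc s (s + ε))).toReal := by
  rw [← ENNReal.ofReal_le_iff_le_toReal (intensityMeasure_Ioc_ne_top hμ_int _ _ hs),
    intensityMeasure_Ioc hs]
  calc ENNReal.ofReal (c * ε) = ∫⁻ _ in Set.Ioc s (s + ε), ENNReal.ofReal c := by
        rw [setLIntegral_const, Real.volume_Ioc, add_sub_cancel_left, ENNReal.ofReal_mul hc]
    _ ≤ ∫⁻ x in Set.Ioc s (s + ε), ENNReal.ofReal (μ x) :=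
        setLIntegral_mono' measurableSet_Ioc fun x hx => ENNReal.ofReal_le_ofReal (h x hx)

end Intensity

theorem hitProb_pos {M : Measure ℝ} {h ε : ℝ} {k : ℕ} (hM : 0 < (M (window h ε k)).toReal) :
    0 < hitProb M h ε k := by
  unfold hitProb
  rw [sub_pos, Real.exp_lt_one_iff]
  linarith

theorem hitProb_le_one (M : Measure ℝ) (h ε : ℝ) (k : ℕ) : hitProb M h ε k ≤ 1 := by
  unfold hitProb
  linarith [Real.exp_pos (-(M (window h ε k)).toReal)]

theorem hitProb_le (M : Measure ℝ) (h ε : ℝ) (k : ℕ) :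
    hitProb M h ε k ≤ (M (window h ε k)).toReal := by
  unfold hitProb
  linarith [Real.add_one_le_exp (-(M (window h ε k)).toReal)]

theorem half_le_one_sub_exp_neg {x : ℝ} (h0 : 0 ≤ x) (h1 : x ≤ 1) : x / 2 ≤ 1 - Real.exp (-x) := by
  have h2 : Real.exp (-x) ≤ 1 / (1 + x) := by
    rw [Real.exp_neg, ← one_div]
    exact one_div_le_one_div_of_le (by linarith) (by linarith [Real.add_one_le_exp x])
  have h3 : 1 / (1 + x) ≤ 1 - x / 2 := by
    rw [div_le_iff₀ (by linarith)]
    nlinarith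
  linarith

/-! ### Logarithmic asymptotics of the bounds -/

/-- A function lying between two functions equivalent to `g → ∞` is equivalent to `g`. -/
theorem isEquivalent_of_le_of_le {α : Type*} {l : Filter α} {u v w g : α → ℝ}
    (hg : Tendsto g l atTop) (hu : Asymptotics.IsEquivalent l u g)
    (hw : Asymptotics.IsEquivalent l w g) (huv : ∀ᶠ x in l, u x ≤ v x)
    (hvw : ∀ᶠ x in l, v x ≤ w x) : Asymptotics.IsEquivalent l v g := by
  have h0 := hg.eventually_gt_atTop 0
  have hne : ∀ᶠ x in l, g x ≠ 0 := h0.mono fun x hx => hx.ne'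
  rw [Asymptotics.isEquivalent_iff_tendsto_one hne] at *
  refine tendsto_of_tendsto_of_tendsto_of_le_of_le' hu hw ?_ ?_
  · filter_upwards [h0, huv] with x h1 h2
    exact div_le_div_of_nonneg_right h2 h1.le
  · filter_upwards [h0, hvw] with x h1 h2
    exact div_le_div_of_nonneg_right h2 h1.le

/-- The function `φ` increases slowly to infinity and `Φ` is asymptotically its primitive. -/
structure IsSlowPrimitive (φ Φ : ℝ → ℝ) : Prop where
  mono : ∀ᶠ T in atTop, MonotoneOn φ (Set.Ici T)
  tendsto : Tendsto φ atTop atTop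
  shift : ∀ c, 0 ≤ c → Asymptotics.IsEquivalent atTop (fun t => φ (t + c)) φ
  primitive_mono : ∀ᶠ T in atTop, MonotoneOn Φ (Set.Ici T)
  primitive_tendsto : Tendsto Φ atTop atTop
  primitive_shift : ∀ c, 0 ≤ c → Asymptotics.IsEquivalent atTop (fun t => Φ (t + c)) Φ
  increment : ∀ h, 0 < h → Asymptotics.IsEquivalent atTop (fun t => (Φ (t + h) - Φ t) / h) φ

section Asymp

variable {μ φ Φ : ℝ → ℝ} {a : ℝ}

theorem tendsto_natCast_mul_atTop {h : ℝ} (hh : 0 < h) :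
    Tendsto (fun k : ℕ => (k : ℝ) * h) atTop atTop :=
  tendsto_natCast_atTop_atTop.atTop_mul_const hh

/-- The window has mass between `a ε exp (-φ (kh + h))` and `a ε exp (-φ (kh))`, and `x / 2 ≤ 1 -
exp (-x) ≤ x` for small `x ≥ 0`. After taking logs the constants are additive and negligible against
`φ → ∞`. -/
theorem neg_log_hitProb_isEquivalent (hμ_int : ∀ t : ℝ, IntegrableOn μ (Set.Ioc 0 t) volume)
    (ha : 0 < a) (hφ : IsSlowPrimitive φ Φ) (hμ : ∀ᶠ t in atTop, μ t = a * Real.exp (-φ t))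
    {h ε : ℝ} (hh : 0 < h) (hε : 0 < ε) (hεh : ε ≤ h) :
    Asymptotics.IsEquivalent atTop
      (fun k : ℕ => -Real.log (hitProb (intensityMeasure μ) h ε k)) (fun k => φ (k * h)) := by
  have hkh := tendsto_natCast_mul_atTop hh
  have hφk : Tendsto (fun k : ℕ => φ (k * h)) atTop atTop := hφ.tendsto.comp hkh
  have hshift : Asymptotics.IsEquivalent atTop (fun k : ℕ => φ (k * h + h))
      (fun k : ℕ => φ (k * h)) := (hφ.shift h hh.le).comp_tendsto hkh
  refine isEquivalent_of_le_of_le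
    (u := fun k : ℕ => φ (k * h) + -Real.log (a * ε))
    (w := fun k : ℕ => φ (k * h + h) + -Real.log (a * ε / 2)) hφk
    (Asymptotics.IsEquivalent.refl.add_const_of_norm_tendsto_atTop
      (tendsto_norm_atTop_atTop.comp hφk))
    (hshift.add_const_of_norm_tendsto_atTop (tendsto_norm_atTop_atTop.comp hφk)) ?_ ?_
  all_goals
    obtain ⟨T, hTmono, hT⟩ := (hφ.mono.and (eventually_forall_ge_atTop.2 hμ)).exists
    have hupper : ∀ k : ℕ, T ≤ k * h → (intensityMeasure μ (window h ε k)).toReal ≤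
        a * Real.exp (-φ (k * h)) * ε := fun k hk => by
      refine intensityMeasure_Ioc_toReal_le (by positivity) hε.le (by positivity) fun x hx => ?_
      rw [hT x (hk.trans hx.1.le)]
      gcongr
      exact hTmono hk (hk.trans hx.1.le) hx.1.le
    have hlower : ∀ k : ℕ, T ≤ k * h → a * Real.exp (-φ (k * h + h)) * ε ≤
        (intensityMeasure μ (window h ε k)).toReal := fun k hk => by
      refine le_intensityMeasure_Ioc_toReal hμ_int (by positivity) (by positivity) fun x hx => ?_
      rw [hT x (hk.trans hx.1.le)]
      gcongr
      exact hTmono (hk.trans hx.1.le) (show T ≤ _ by linarith) (hx.2.trans (by linarith))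
  · filter_upwards [hkh.eventually_ge_atTop T] with k hk
    have hpos : 0 < hitProb (intensityMeasure μ) h ε k :=
      hitProb_pos (lt_of_lt_of_le (by positivity) (hlower k hk))
    have h1 := Real.log_le_log hpos ((hitProb_le _ _ _ _).trans (hupper k hk))
    rw [show a * Real.exp (-φ (k * h)) * ε = a * ε * Real.exp (-φ (k * h)) by ring,
      Real.log_mul (by positivity) (by positivity), Real.log_exp] at h1
    linarith
  · have hsmall : Tendsto (fun k : ℕ => a * Real.exp (-φ (k * h)) * ε) atTop (𝓝 0) := by
      have := ((Real.tendsto_exp_neg_atTop_nhds_zero.comp hφk).const_mul a).mul_const ε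
      simpa using this
    filter_upwards [hkh.eventually_ge_atTop T, hsmall.eventually (ge_mem_nhds one_pos)]
      with k hk hk1
    have h0 : 0 < a * Real.exp (-φ (k * h + h)) * ε := by positivity
    have h1 : a * Real.exp (-φ (k * h + h)) * ε / 2 ≤ hitProb (intensityMeasure μ) h ε k :=
      (div_le_div_of_nonneg_right (hlower k hk) two_pos.le).trans
        (half_le_one_sub_exp_neg ENNReal.toReal_nonneg ((hupper k hk).trans hk1))
    have h2 := Real.log_le_log (by positivity) h1
    rw [show a * Real.exp (-φ (k * h + h)) * ε / 2 = a * ε / 2 * Real.exp (-φ (k * h + h)) by ring,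
      Real.log_mul (by positivity) (by positivity), Real.log_exp] at h2
    linarith

/-- Each term is equivalent to `(Φ (kh + h) - Φ (kh)) / h`. Equivalence passes to partial sums since
the terms are nonnegative with divergent sum, and the increments telescope. -/
theorem sum_neg_log_hitProb_isEquivalent
    (hμ_pos : ∀ᵐ t ∂(volume.restrict (Set.Ioi (0 : ℝ))), 0 < μ t)
    (hμ_int : ∀ t : ℝ, IntegrableOn μ (Set.Ioc 0 t) volume)
    (ha : 0 < a) (hφ : IsSlowPrimitive φ Φ) (hμ : ∀ᶠ t in atTop, μ t = a * Real.exp (-φ t))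
    {h ε : ℝ} (hh : 0 < h) (hε : 0 < ε) (hεh : ε ≤ h) :
    Asymptotics.IsEquivalent atTop
      (fun n : ℕ => ∑ k ∈ Finset.range n, -Real.log (hitProb (intensityMeasure μ) h ε k))
      (fun n => Φ (n * h) / h) := by
  have hkh := tendsto_natCast_mul_atTop hh
  set g : ℕ → ℝ := fun k => -Real.log (hitProb (intensityMeasure μ) h ε k) with hg
  have hg0 : ∀ k, 0 ≤ g k := fun k => by
    have hpos : 0 < hitProb (intensityMeasure μ) h ε k :=
      hitProb_pos (intensityMeasure_Ioc_toReal_pos hμ_pos hμ_int (by positivity) (by linarith))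
    exact neg_nonneg.2 (Real.log_nonpos hpos.le (hitProb_le_one _ _ _ _))
  have hgφ := neg_log_hitProb_isEquivalent hμ_int ha hφ hμ hh hε hεh
  have hgtop : Tendsto g atTop atTop := hgφ.symm.tendsto_atTop (hφ.tendsto.comp hkh)
  have hsum : Tendsto (fun n => ∑ k ∈ Finset.range n, g k) atTop atTop := by
    rw [← not_summable_iff_tendsto_nat_atTop_of_nonneg hg0]
    exact fun hs => not_tendsto_nhds_of_tendsto_atTop hgtop 0 hs.tendsto_atTop_zero
  have hinc : Asymptotics.IsEquivalent atTop (fun k : ℕ => (Φ (k * h + h) - Φ (k * h)) / h) g :=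
    ((hφ.increment h hh).comp_tendsto hkh).trans hgφ.symm
  have h1 := hinc.isLittleO.sum_range hg0 hsum
  have h2 : Asymptotics.IsEquivalent atTop (fun n : ℕ => (Φ (n * h) - Φ 0) / h)
      (fun n => ∑ k ∈ Finset.range n, g k) := by
    refine h1.congr_left fun n => ?_
    simp only [Pi.sub_apply, Finset.sum_sub_distrib, ← Finset.sum_div]
    congr 2
    have := Finset.sum_range_sub (fun k : ℕ => Φ (k * h)) n
    simp only [Nat.cast_add, Nat.cast_one, Nat.cast_zero, zero_mul, add_mul, one_mul,
      Finset.sum_sub_distrib] at this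
    exact this
  -- The boundary term of the telescoping sum is absorbed by divergence.
  have h3 := h2.add_const_of_norm_tendsto_atTop (c := Φ 0 / h)
    (tendsto_norm_atTop_atTop.comp hsum)
  refine (h3.congr_left (Eventually.of_forall fun n => ?_)).symm
  simp only
  ring

theorem tendsto_floor_div_add {h : ℝ} (hh : 0 < h) (j : ℕ) :
    Tendsto (fun t : ℝ => ⌊t / h⌋₊ + j) atTop atTop :=
  tendsto_atTop_mono (fun _ => Nat.le_add_right _ _) (tendsto_nat_floor_atTop.comp (tendsto_id.atTop_div_const hh))

/-- The rounded argument lies in `[t, t + j h]`; `j ≥ 1` compensates for the floor. -/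
theorem IsSlowPrimitive.floor_isEquivalent (hφ : IsSlowPrimitive φ Φ) {h : ℝ} (hh : 0 < h)
    {j : ℕ} (hj : 1 ≤ j) :
    Asymptotics.IsEquivalent atTop (fun t => Φ ((⌊t / h⌋₊ + j : ℕ) * h)) Φ := by
  have hlow : ∀ t, t ≤ (⌊t / h⌋₊ + j : ℕ) * h := fun t => by
    rw [← div_le_iff₀ hh]
    have h1 : (1 : ℝ) ≤ j := by exact_mod_cast hj
    push_cast
    linarith [Nat.lt_floor_add_one (t / h)]
  obtain ⟨T, hT⟩ := hφ.primitive_mono.exists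
  refine isEquivalent_of_le_of_le hφ.primitive_tendsto Asymptotics.IsEquivalent.refl
    (hφ.primitive_shift (j * h) (by positivity)) ?_ ?_
  · filter_upwards [eventually_ge_atTop T] with t ht
    exact hT ht (ht.trans (hlow t)) (hlow t)
  · filter_upwards [eventually_ge_atTop T, eventually_ge_atTop 0] with t ht ht0
    have hup : ((⌊t / h⌋₊ + j : ℕ) : ℝ) * h ≤ t + j * h := by
      push_cast
      have h1 := (le_div_iff₀ hh).1 (Nat.floor_le (a := t / h) (by positivity))
      linarith
    exact hT (ht.trans (hlow t)) (ht.trans ((hlow t).trans hup)) hup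

theorem tendsto_sum_neg_log_hitProb_div
    (hμ_pos : ∀ᵐ t ∂(volume.restrict (Set.Ioi (0 : ℝ))), 0 < μ t)
    (hμ_int : ∀ t : ℝ, IntegrableOn μ (Set.Ioc 0 t) volume)
    (ha : 0 < a) (hφ : IsSlowPrimitive φ Φ) (hμ : ∀ᶠ t in atTop, μ t = a * Real.exp (-φ t))
    {h ε : ℝ} (hh : 0 < h) (hε : 0 < ε) (hεh : ε ≤ h) {j : ℕ} (hj : 1 ≤ j) (ℓ : ℝ) :
    Tendsto (fun t => (∑ k ∈ Finset.range (⌊t / h⌋₊ + j),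
      -Real.log (hitProb (intensityMeasure μ) h ε k)) / (Φ t / ℓ)) atTop (𝓝 (ℓ / h)) := by
  have h1 := (sum_neg_log_hitProb_isEquivalent hμ_pos hμ_int ha hφ hμ hh hε hεh).comp_tendsto
    (tendsto_floor_div_add hh j)
  have h2 := h1.trans ((hφ.floor_isEquivalent hh hj).div
    (Asymptotics.IsEquivalent.refl (u := fun _ => h)))
  have h0 := hφ.primitive_tendsto.eventually_gt_atTop 0
  have hne : ∀ᶠ t in atTop, (fun t => Φ t / h) t ≠ 0 := h0.mono fun t ht => (div_pos ht hh).ne'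
  have h3 := ((Asymptotics.isEquivalent_iff_tendsto_one hne).1 h2).mul_const (ℓ / h)
  rw [one_mul] at h3
  refine h3.congr fun t => ?_
  simp only [Pi.div_apply, Function.comp_apply]
  field_simp

/-- If the rate function is eventually `a * exp (-φ t)` and `Φ` is an asymptotic primitive of `φ`,
then `-log ℙ(D > t)` is asymptotic to `Φ t / ℓ`. -/
theorem tendsto_log_measureReal_lt_firstGap_div {Ω : Type*} [MeasurableSpace Ω] {P : Measure Ω}
    [IsProbabilityMeasure P]
    (hμ_pos : ∀ᵐ t ∂(volume.restrict (Set.Ioi (0 : ℝ))), 0 < μ t)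
    (hμ_int : ∀ t : ℝ, IntegrableOn μ (Set.Ioc 0 t) volume)
    {N : Ω → Set ℝ} (hN : IsPoissonProcess P N (intensityMeasure μ)) {ℓ : ℝ} (hℓ : 0 < ℓ)
    (ha : 0 < a) (hφ : IsSlowPrimitive φ Φ) (hμ : ∀ᶠ t in atTop, μ t = a * Real.exp (-φ t)) :
    Tendsto (fun t : ℝ => Real.log (P.real {ω | (t : EReal) < firstGap (N ω) ℓ}) / -(Φ t / ℓ))
      atTop (𝓝 1) := by
  have hM := intensityMeasure_Ioc_ne_top hμ_int
  have hΦ := hφ.primitive_tendsto.eventually_gt_atTop 0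
  have hp : ∀ {h ε : ℝ} (k : ℕ), 0 < h → 0 < ε → 0 < hitProb (intensityMeasure μ) h ε k :=
    fun k hh hε => hitProb_pos
      (intensityMeasure_Ioc_toReal_pos hμ_pos hμ_int (by positivity) (by linarith))
  have hlogprod : ∀ {h ε : ℝ} (n : ℕ), 0 < h → 0 < ε →
      Real.log (∏ k ∈ Finset.range n, hitProb (intensityMeasure μ) h ε k) =
        -∑ k ∈ Finset.range n, -Real.log (hitProb (intensityMeasure μ) h ε k) := by
    intro h ε n hh hε
    rw [Real.log_prod fun k _ => (hp k hh hε).ne', Finset.sum_neg_distrib, neg_neg]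
  have hlow : ∀ h ε : ℝ, 0 < h → 0 < ε → ε ≤ h → h + ε ≤ ℓ → ∀ t : ℝ,
      0 < P.real {ω | (t : EReal) < firstGap (N ω) ℓ} ∧
      -Real.log (P.real {ω | (t : EReal) < firstGap (N ω) ℓ}) ≤
        ∑ k ∈ Finset.range (⌊t / h⌋₊ + 2), -Real.log (hitProb (intensityMeasure μ) h ε k) := by
    intro h ε hh hε hεh hhε t
    have h1 := hN.le_measureReal_lt_firstGap hM hh hεh hhε t
    have h2 : 0 < ∏ k ∈ Finset.range (⌊t / h⌋₊ + 2), hitProb (intensityMeasure μ) h ε k :=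
      Finset.prod_pos fun k _ => hp k hh hε
    have h3 := Real.log_le_log h2 h1
    rw [hlogprod _ hh hε] at h3
    exact ⟨h2.trans_le h1, by linarith⟩
  have hup : ∀ t : ℝ, 0 ≤ t → ∑ k ∈ Finset.range (⌊t / ℓ⌋₊ + 1),
      -Real.log (hitProb (intensityMeasure μ) ℓ ℓ k) ≤
        -Real.log (P.real {ω | (t : EReal) < firstGap (N ω) ℓ}) := by
    intro t ht
    have h1 := Real.log_le_log
      -- Any admissible pair would do: only positivity of the probability is wanted.
      (hlow (ℓ / 2) (ℓ / 2) (by positivity) (by positivity) le_rfl (by linarith) t).1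
      (hN.measureReal_lt_firstGap_le hM hℓ ht)
    rw [hlogprod _ hℓ hℓ] at h1
    linarith
  have hneg : ∀ x y : ℝ, x / -y = -x / y := fun x y => by rw [div_neg, neg_div]
  simp only [hneg]
  rw [tendsto_order]
  constructor
  · intro c hc
    have h1 := tendsto_sum_neg_log_hitProb_div hμ_pos hμ_int ha hφ hμ hℓ hℓ le_rfl le_rfl ℓ
    rw [div_self hℓ.ne'] at h1
    filter_upwards [h1.eventually (lt_mem_nhds hc), hΦ, eventually_ge_atTop 0] with t h2 h3 h4
    exact h2.trans_le (div_le_div_of_nonneg_right (hup t h4) (by positivity))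
  · intro c hc
    -- With `h = ℓ - ε` the limiting ratio is `ℓ / (ℓ - ε)`, and `ε ≤ ℓ / 2` gives `ε ≤ h`, so the
    -- windows are disjoint.
    obtain ⟨ε, hε0, hεℓ, hεc⟩ : ∃ ε, 0 < ε ∧ ε ≤ ℓ / 2 ∧ ℓ / (ℓ - ε) < c := by
      have h1 : Tendsto (fun ε => ℓ / (ℓ - ε)) (𝓝[>] 0) (𝓝 1) := by
        have : ContinuousAt (fun ε => ℓ / (ℓ - ε)) 0 := by
          refine continuousAt_const.div (by fun_prop) ?_
          simpa using hℓ.ne'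
        have := this.tendsto
        rw [sub_zero, div_self hℓ.ne'] at this
        exact this.mono_left nhdsWithin_le_nhds
      have h2 : ∀ᶠ ε in 𝓝[>] (0 : ℝ), ε ≤ ℓ / 2 :=
        nhdsWithin_le_nhds (ge_mem_nhds (by positivity))
      obtain ⟨ε, h3, h4, h5⟩ :=
        ((h1.eventually (gt_mem_nhds hc)).and (h2.and self_mem_nhdsWithin)).exists
      exact ⟨ε, h5, h4, h3⟩
    have hh : 0 < ℓ - ε := by linarith
    have h1 := tendsto_sum_neg_log_hitProb_div hμ_pos hμ_int ha hφ hμ hh hε0 (by linarith)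
      one_le_two ℓ
    filter_upwards [h1.eventually (gt_mem_nhds hεc), hΦ] with t h2 h3
    exact lt_of_le_of_lt (div_le_div_of_nonneg_right
      (hlow (ℓ - ε) ε hh hε0 (by linarith) (by linarith) t).2 (by positivity)) h2

end Asymp

/-! ### The three rate functions -/

theorem isEquivalent_of_sub_mem_Icc {u g : ℝ → ℝ} {C : ℝ} (hg : Tendsto g atTop atTop)
    (h : ∀ᶠ t in atTop, u t - g t ∈ Set.Icc 0 C) : Asymptotics.IsEquivalent atTop u g := by
  refine isEquivalent_of_le_of_le hg Asymptotics.IsEquivalent.refl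
    (Asymptotics.IsEquivalent.refl.add_const_of_norm_tendsto_atTop (c := C)
      (tendsto_norm_atTop_atTop.comp hg)) ?_ ?_
  · filter_upwards [h] with t ht
    linarith [ht.1]
  · filter_upwards [h] with t ht
    linarith [ht.2]

theorem isEquivalent_add_const_atTop {c : ℝ} (hc : 0 ≤ c) :
    Asymptotics.IsEquivalent atTop (fun t : ℝ => t + c) fun t => t :=
  isEquivalent_of_sub_mem_Icc (C := c) tendsto_id (Eventually.of_forall fun t => by simp [hc])

theorem isSlowPrimitive_linear {b : ℝ} (hb : 0 < b) :
    IsSlowPrimitive (fun t => b * t) (fun t => b * t ^ 2 / 2) where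
  mono := Eventually.of_forall fun T x _ y _ hxy => by dsimp only; gcongr
  tendsto := tendsto_id.const_mul_atTop hb
  shift c hc := isEquivalent_of_sub_mem_Icc (C := b * c) (tendsto_id.const_mul_atTop hb)
    (Eventually.of_forall fun t => by
      have : 0 ≤ b * c := by positivity
      constructor <;> linarith)
  primitive_mono := by
    filter_upwards [eventually_ge_atTop 0] with T hT x hx y _ hxy
    have : 0 ≤ x := hT.trans hx
    dsimp only
    gcongr
  primitive_tendsto :=
    ((tendsto_pow_atTop two_ne_zero).const_mul_atTop hb).atTop_div_const two_pos
  primitive_shift c hc :=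
    ((Asymptotics.IsEquivalent.refl (u := fun _ => b)).mul
      ((isEquivalent_add_const_atTop hc).pow 2)).div
        (Asymptotics.IsEquivalent.refl (u := fun _ => (2 : ℝ)))
  -- For a quadratic `Φ` the difference quotient exceeds `φ` by exactly `b h / 2`.
  increment h hh := isEquivalent_of_sub_mem_Icc (C := b * h / 2) (tendsto_id.const_mul_atTop hb)
    (Eventually.of_forall fun t => by
      have h1 : (b * (t + h) ^ 2 / 2 - b * t ^ 2 / 2) / h - b * t = b * h / 2 := by
        field_simp
        ring
      rw [h1]
      exact ⟨by positivity, le_rfl⟩)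

/-- Increments of `L` of order `1 / t` stay bounded after multiplication by `t`, so `t L t` behaves
as a primitive of `L` up to a bounded error in the difference quotient. -/
theorem isSlowPrimitive_of_slow {b : ℝ} (hb : 0 < b) {L : ℝ → ℝ}
    (hmono : ∀ᶠ T in atTop, MonotoneOn L (Set.Ici T)) (hL : Tendsto L atTop atTop)
    (hinc : ∀ c, 0 ≤ c → ∀ᶠ t in atTop, L (t + c) - L t ≤ c / t) :
    IsSlowPrimitive (fun t => b * L t) (fun t => b * t * L t) := by
  have hφ : Tendsto (fun t => b * L t) atTop atTop := hL.const_mul_atTop hb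
  have hinc' : ∀ c, 0 ≤ c → ∀ᶠ t in atTop, 1 ≤ t ∧ 0 ≤ L (t + c) - L t ∧
      L (t + c) - L t ≤ c ∧ t * (L (t + c) - L t) ≤ c := by
    intro c hc
    obtain ⟨T, hT⟩ := hmono.exists
    filter_upwards [hinc c hc, eventually_ge_atTop T, eventually_ge_atTop 1] with t h1 h2 h3
    refine ⟨h3, sub_nonneg.2 (hT h2 (show T ≤ _ by linarith) (by linarith)),
      h1.trans (div_le_self hc h3), ?_⟩
    rw [le_div_iff₀ (by linarith)] at h1
    linarith
  have hshift : ∀ c, 0 ≤ c → Asymptotics.IsEquivalent atTop (fun t => L (t + c)) L := fun c hc =>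
    isEquivalent_of_sub_mem_Icc (C := c) hL ((hinc' c hc).mono fun t ht => ⟨ht.2.1, ht.2.2.1⟩)
  have hid : ∀ c, 0 ≤ c → Asymptotics.IsEquivalent atTop (fun t => b * (t + c))
      (fun t : ℝ => b * t) := fun c hc =>
    (Asymptotics.IsEquivalent.refl (u := fun _ => b)).mul (isEquivalent_add_const_atTop hc)
  refine ⟨?_, hφ, ?_, ?_, (tendsto_id.const_mul_atTop hb).atTop_mul_atTop₀ hL, ?_, ?_⟩
  · filter_upwards [hmono] with T hT x hx y hy hxy
    exact mul_le_mul_of_nonneg_left (hT hx hy hxy) hb.le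
  · exact fun c hc => (Asymptotics.IsEquivalent.refl (u := fun _ => b)).mul (hshift c hc)
  · filter_upwards [hmono, eventually_ge_atTop 0, hL.eventually_ge_atTop 0]
      with T hT hT0 hLT x hx y hy hxy
    have h1 : 0 ≤ L x := hLT.trans (hT Set.self_mem_Ici hx hx)
    have h2 : 0 ≤ y := hT0.trans hy
    exact mul_le_mul (mul_le_mul_of_nonneg_left hxy hb.le) (hT hx hy hxy) h1 (by positivity)
  · exact fun c hc => (hid c hc).mul (hshift c hc)
  · intro h hh
    refine isEquivalent_of_sub_mem_Icc (C := b * h + b) hφ ?_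
    filter_upwards [hinc' h hh.le] with t ⟨h1, h2, h3, h4⟩
    -- Discrete product rule; both terms on the right are bounded.
    have h5 : (b * (t + h) * L (t + h) - b * t * L t) / h - b * L t =
        b * (L (t + h) - L t) + b * (t * (L (t + h) - L t) / h) := by
      field_simp
      ring
    rw [h5]
    have h6 : t * (L (t + h) - L t) / h ≤ 1 := (div_le_one hh).2 h4
    refine ⟨by positivity, add_le_add (by gcongr) ?_⟩
    nlinarith

theorem log_sub_log_le_div {x y : ℝ} (hx : 0 < x) (hxy : x ≤ y) :
    Real.log y - Real.log x ≤ (y - x) / x := by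
  rw [← Real.log_div (hx.trans_le hxy).ne' hx.ne', sub_div, div_self hx.ne']
  exact Real.log_le_sub_one_of_pos (div_pos (hx.trans_le hxy) hx)

theorem isSlowPrimitive_log {b : ℝ} (hb : 0 < b) :
    IsSlowPrimitive (fun t => b * Real.log t) (fun t => b * t * Real.log t) := by
  refine isSlowPrimitive_of_slow hb ?_ Real.tendsto_log_atTop fun c hc => ?_
  · filter_upwards [eventually_gt_atTop 0] with T hT x hx y _ hxy
    exact Real.log_le_log (hT.trans_le hx) hxy
  · filter_upwards [eventually_gt_atTop 0] with t ht
    simpa using log_sub_log_le_div ht (le_add_of_nonneg_right hc)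

theorem isSlowPrimitive_log_log {b : ℝ} (hb : 0 < b) :
    IsSlowPrimitive (fun t => b * Real.log (Real.log t))
      (fun t => b * t * Real.log (Real.log t)) := by
  refine isSlowPrimitive_of_slow hb ?_
    (Real.tendsto_log_atTop.comp Real.tendsto_log_atTop) fun c hc => ?_
  · filter_upwards [eventually_gt_atTop 1] with T hT x hx y _ hxy
    have h1 : 1 < x := hT.trans_le hx
    exact Real.log_le_log (Real.log_pos h1) (Real.log_le_log (by linarith) hxy)
  -- Once `log t ≥ 1`, the increment of `log log` is at most that of `log`.
  · filter_upwards [eventually_gt_atTop 0, Real.tendsto_log_atTop.eventually_ge_atTop 1]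
      with t ht hlog
    have h1 : Real.log t ≤ Real.log (t + c) := Real.log_le_log ht (by linarith)
    have h2 := log_sub_log_le_div ht (le_add_of_nonneg_right hc)
    rw [add_sub_cancel_left] at h2
    exact (log_sub_log_le_div (by linarith) h1).trans
      ((div_le_self (sub_nonneg.2 h1) hlog).trans h2)

theorem mainTheorem6 {Ω : Type*} [MeasurableSpace Ω] (P : Measure Ω) [IsProbabilityMeasure P]
    (μ : ℝ → ℝ)
    (hμ_pos : ∀ᵐ t ∂(volume.restrict (Set.Ioi (0 : ℝ))), 0 < μ t)
    (hμ_int : ∀ t : ℝ, IntegrableOn μ (Set.Ioc 0 t) volume)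
    (N : Ω → Set ℝ) (hN : IsPoissonProcess P N (intensityMeasure μ))
    (ℓ : ℝ) (hℓ : 0 < ℓ) (a b : ℝ) (ha : 0 < a) (hb : 0 < b) :
    ((∀ᶠ t in atTop, μ t = a * (Real.log t) ^ (-b)) →
      ApproxLog (fun t => P.real {ω | (t : EReal) < firstGap (N ω) ℓ})
        (fun t => Real.exp (-(b * t * Real.log (Real.log t) / ℓ)))) ∧
    ((∀ᶠ t in atTop, μ t = a * t ^ (-b)) →
      ApproxLog (fun t => P.real {ω | (t : EReal) < firstGap (N ω) ℓ})
        (fun t => Real.exp (-(b * t * Real.log t / ℓ)))) ∧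
    ((∀ᶠ t in atTop, μ t = a * Real.exp (-(b * t))) →
      ApproxLog (fun t => P.real {ω | (t : EReal) < firstGap (N ω) ℓ})
        (fun t => Real.exp (-(b * t ^ 2 / (2 * ℓ))))) := by
  refine ⟨fun hμ => ?_, fun hμ => ?_, fun hμ => ?_⟩ <;> unfold ApproxLog <;>
    simp only [Real.log_exp]
  · refine tendsto_log_measureReal_lt_firstGap_div hμ_pos hμ_int hN hℓ ha
      (isSlowPrimitive_log_log hb) ?_
    filter_upwards [hμ, Real.tendsto_log_atTop.eventually_gt_atTop 0] with t h1 h2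
    rw [h1, Real.rpow_def_of_pos h2]
    ring_nf
  · refine tendsto_log_measureReal_lt_firstGap_div hμ_pos hμ_int hN hℓ ha
      (isSlowPrimitive_log hb) ?_
    filter_upwards [hμ, eventually_gt_atTop 0] with t h1 h2
    rw [h1, Real.rpow_def_of_pos h2]
    ring_nf
  · have h := tendsto_log_measureReal_lt_firstGap_div hμ_pos hμ_int hN hℓ ha
      (isSlowPrimitive_linear hb) hμ
    simpa only [div_div] using h
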